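/- Let $G$ be a compact Lie group with normalized Haar measure $dx$ and a bi-invariant Riemannian metric, and let $\mathcal L$ be its Laplace–Beltrami operator (the Casimir element). For $[\xi]$ in the unitary dual $\widehat G$, let $d_\xi$ be the dimension of $\xi$, let $\lambda_\xi^2$ be the eigenvalue of $-\mathcal L$ on the matrix coefficients of $\xi$, and put $\widehat f(\xi)=\int_G f(x)\xi(x)^*\,dx$. For $0<\alpha<1$ let $$(-\mathcal L)^{\alpha}f=\sum_{[\xi]\in\widehat G}d_\xi\,\lambda_\xi^{2\alpha}\operatorname{Tr}\big(\xi(\cdot)\widehat f(\xi)\big),$$ and let $H^\alpha_{\mathcal L}(G)$ be the space of $f\in L^2(G)$ with finite norm $\|f\|_{L^2}+\|(-\mathcal L)^{\alpha/2}f\|_{L^2}$, where $\|(-\mathcal L)^{\alpha/2}f\|_{L^2}^2=\sum_{[\xi]\in\widehat G}d_\xi\lambda_\xi^{2\alpha}\|\widehat f(\xi)\|_{HS}^2$. Let $p>1$ and consider, for $\varepsilon>0$, the Cauchy problem $$\partial_t^2u+(-\mathcal L)^\alpha u=|u|^p,\qquad u(0,x)=\varepsilon u_0(x),\qquad \partial_tu(0,x)=\varepsilon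 u_1(x)\qquad (x\in G,\ t>0).$$ For $0<T\le\infty$, an energy solution on $[0,T)$ is a (complex-valued) function $u\in C([0,T),H^\alpha_{\mathcal L}(G))\cap C^1([0,T),L^2(G))\cap L^p_{\rm loc}([0,T)\times G)$ such that $$\begin{aligned}&\int_G\partial_tu(t,x)\phi(t,x)\,dx-\int_Gu(t,x)\,\partial_s\phi(t,x)\,dx+\varepsilon\int_Gu_0(x)\,\partial_s\phi(0,x)\,dx-\varepsilon\int_Gu_1(x)\phi(0,x)\,dx\\&\quad+\int_0^t\!\int_Gu(s,x)\big(\partial_s^2\phi(s,x)+(-\mathcal L)^\alpha\phi(s,x)\big)\,dx\,ds=\int_0^t\!\int_G|u(s,x)|^p\phi(s,x)\,dx\,ds\end{aligned}$$ for every $\phi\in C_0^\infty([0,T)\times G)$ and every $t\in(0,T)$. The lifespan $T(\varepsilon)\in[0,\infty]$ is the supremum of all $T$ for which there is an energy solution on $[0,T)$. **Theorem.** Let $p>1$ and let $u_0,u_1\in L^2(G)$ be nonnegative and not both zero. There is $\varepsilon_0=\varepsilon_0(u_0,u_1,p)>0$ such that, for every $0<\alpha<1$ with $u_0\in H^\alpha_{\mathcal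 L}(G)$, there is a constant $C>0$ independent of $\varepsilon$ with the following property. For every $\varepsilon\in(0,\varepsilon_0]$, every energy solution blows up in finite time, that is, every energy solution on an interval $[0,T)$, $0<T\le\infty$, has $T<\infty$; moreover $$T(\varepsilon)\le C\,\varepsilon^{-\frac{p-1}{b(p)}},\qquad b(p)=\begin{cases}p+1&\text{if }u_1\neq0,\\2&\text{if }u_1=0.\end{cases}$$ -/

import Mathlib

open MeasureTheory Set Filter Topology
open scoped Manifold ContDiff Matrix ENNReal ComplexOrder

noncomputable section

namespace FracWave

section Laplacian

variable (E : Type*) [NormedAddCommGroup E] [NormedSpace ℝ E]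
variable (G : Type*) [TopologicalSpace G] [ChartedSpace E G] [Group G]

/-- The adjoint representation `Ad g : 𝔤 → 𝔤` of a Lie group, i.e. the derivative at the identity
of the conjugation `x ↦ g x g⁻¹`. -/
def adjointAction (g : G) (v : GroupLieAlgebra 𝓘(ℝ, E) G) : GroupLieAlgebra 𝓘(ℝ, E) G :=
  mfderiv 𝓘(ℝ, E) 𝓘(ℝ, E) (fun x : G => g * x * g⁻¹) 1 v

/-- A bi-invariant Riemannian metric on a Lie group, given by its value at the identity: an
`Ad`-invariant inner product on the Lie algebra. -/
structure BiinvariantMetric where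
  form : LinearMap.BilinForm ℝ (GroupLieAlgebra 𝓘(ℝ, E) G)
  symm : ∀ v w, form v w = form w v
  pos : ∀ v, v ≠ 0 → 0 < form v v
  ad_invariant : ∀ (g : G) v w,
    form (adjointAction E G g v) (adjointAction E G g w) = form v w

variable {E G}

/-- The derivative of a function along the left-invariant vector field generated by `v ∈ 𝔤`. -/
def leftDeriv (v : GroupLieAlgebra 𝓘(ℝ, E) G) (f : G → ℂ) (x : G) : ℂ :=
  mfderiv 𝓘(ℝ, E) 𝓘(ℝ, ℂ) f x (mulInvariantVectorField v x)

instance finiteDimensional_lieAlgebra [FiniteDimensional ℝ E] :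
    FiniteDimensional ℝ (GroupLieAlgebra 𝓘(ℝ, E) G) :=
  inferInstanceAs (FiniteDimensional ℝ E)

namespace BiinvariantMetric

variable [FiniteDimensional ℝ E] (𝔪 : BiinvariantMetric E G)

/-- The Gram matrix of the metric in a basis of the Lie algebra. -/
def gram : Matrix (Fin (Module.finrank ℝ (GroupLieAlgebra 𝓘(ℝ, E) G)))
    (Fin (Module.finrank ℝ (GroupLieAlgebra 𝓘(ℝ, E) G))) ℝ :=
  Matrix.of fun i j =>
    𝔪.form (Module.finBasis ℝ (GroupLieAlgebra 𝓘(ℝ, E) G) i)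
      (Module.finBasis ℝ (GroupLieAlgebra 𝓘(ℝ, E) G) j)

/-- The Laplace-Beltrami operator of a bi-invariant metric, as the Casimir element
`∑ i j, g^{ij} X_i X_j` acting through left-invariant vector fields. The value does not depend on
the basis `X_i`; in an orthonormal basis it is `∑ i, X_i²`. -/
def laplacian (f : G → ℂ) (x : G) : ℂ :=
  ∑ i, ∑ j, ((𝔪.gram⁻¹ i j : ℝ) : ℂ) *
    leftDeriv (Module.finBasis ℝ (GroupLieAlgebra 𝓘(ℝ, E) G) i)
      (leftDeriv (Module.finBasis ℝ (GroupLieAlgebra 𝓘(ℝ, E) G) j) f) x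

end BiinvariantMetric

end Laplacian

section UnitaryDual

variable (G : Type*) [TopologicalSpace G] [Group G]

/-- A continuous irreducible unitary matrix representation of `G`. -/
structure UnitaryIrrep where
  dim : ℕ
  dim_pos : 0 < dim
  hom : G →* Matrix.unitaryGroup (Fin dim) ℂ
  continuous_hom : Continuous hom
  irreducible : ∀ W : Submodule ℂ (Fin dim → ℂ),
    (∀ x : G, ∀ v ∈ W, (hom x : Matrix (Fin dim) (Fin dim) ℂ) *ᵥ v ∈ W) → W = ⊥ ∨ W = ⊤

variable {G}

/-- The matrix `ξ(x)`. -/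
def UnitaryIrrep.mat (ξ : UnitaryIrrep G) (x : G) : Matrix (Fin ξ.dim) (Fin ξ.dim) ℂ :=
  (ξ.hom x : Matrix (Fin ξ.dim) (Fin ξ.dim) ℂ)

variable (G)

/-- Equivalence of representations: there is an invertible intertwining operator. -/
instance unitaryIrrepSetoid : Setoid (UnitaryIrrep G) where
  r ξ η := ∃ A : (Fin ξ.dim → ℂ) ≃ₗ[ℂ] (Fin η.dim → ℂ),
    ∀ (x : G) (v : Fin ξ.dim → ℂ), A (ξ.mat x *ᵥ v) = η.mat x *ᵥ A v
  iseqv :=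
    { refl := fun ξ => ⟨LinearEquiv.refl ℂ _, fun _ _ => rfl⟩
      symm := by
        rintro ξ η ⟨A, hA⟩
        refine ⟨A.symm, fun x v => ?_⟩
        rw [LinearEquiv.symm_apply_eq, hA, LinearEquiv.apply_symm_apply]
      trans := by
        rintro ξ η ζ ⟨A, hA⟩ ⟨B, hB⟩
        refine ⟨A.trans B, fun x v => ?_⟩
        rw [LinearEquiv.trans_apply, LinearEquiv.trans_apply, hA, hB] }

/-- The unitary dual `Ĝ`: equivalence classes of continuous irreducible unitary representations. -/
def UnitaryDual : Type _ := Quotient (unitaryIrrepSetoid G)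

variable {G}

/-- A chosen representative of a class in the unitary dual. The quantities used below do not depend
on this choice. -/
def UnitaryDual.rep (ξ : UnitaryDual G) : UnitaryIrrep G := Quotient.out ξ

end UnitaryDual

section Fourier

variable {G : Type*} [TopologicalSpace G] [Group G] [MeasurableSpace G]

/-- The group Fourier transform `f̂(ξ) = ∫_G f(x) ξ(x)* dx`, computed entrywise. -/
def fourierCoeff (μ : Measure G) (f : G → ℂ) (ξ : UnitaryIrrep G) :
    Matrix (Fin ξ.dim) (Fin ξ.dim) ℂ :=
  Matrix.of fun i j => ∫ x, f x * (ξ.mat x)ᴴ i j ∂μ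

variable {E : Type*} [NormedAddCommGroup E] [NormedSpace ℝ E] [FiniteDimensional ℝ E]
variable [ChartedSpace E G]

/-- The number `λ_ξ²`: the common eigenvalue of `-𝓛` on the matrix coefficients `ξ_{ij}`, that is,
the unique real number with `-𝓛 ξ_{ij} = λ_ξ² ξ_{ij}` for all `i, j`. -/
def eigenvalue (𝔪 : BiinvariantMetric E G) (ξ : UnitaryIrrep G) : ℝ :=
  Classical.epsilon fun l : ℝ => ∀ (i j : Fin ξ.dim) (x : G),
    -𝔪.laplacian (fun y => ξ.mat y i j) x = (l : ℂ) * ξ.mat x i j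

/-- The fractional Laplace-Beltrami operator `(-𝓛)^α` with Fourier multiplier `λ_ξ^{2α}`:
`((-𝓛)^α f)(x) = ∑_{[ξ] ∈ Ĝ} d_ξ λ_ξ^{2α} Tr(ξ(x) f̂(ξ))`. -/
def fracLaplacian (𝔪 : BiinvariantMetric E G) (μ : Measure G) (α : ℝ) (f : G → ℂ) (x : G) : ℂ :=
  ∑' ξ : UnitaryDual G, (ξ.rep.dim : ℂ) * ((eigenvalue 𝔪 ξ.rep ^ α : ℝ) : ℂ) *
    (ξ.rep.mat x * fourierCoeff μ f ξ.rep).trace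

/-- The Sobolev norm `‖f‖_{L²} + ‖(-𝓛)^{α/2} f‖_{L²}` with
`‖(-𝓛)^{α/2} f‖_{L²}² = ∑_{[ξ] ∈ Ĝ} d_ξ λ_ξ^{2α} ‖f̂(ξ)‖_HS²`, with values in `[0, ∞]`. -/
def sobolevNorm (𝔪 : BiinvariantMetric E G) (μ : Measure G) (α : ℝ) (f : Lp ℂ 2 μ) : ℝ≥0∞ :=
  ENNReal.ofReal ‖f‖ +
    (∑' ξ : UnitaryDual G, ENNReal.ofReal ((ξ.rep.dim : ℝ) * eigenvalue 𝔪 ξ.rep ^ α *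
      ∑ i, ∑ j, ‖fourierCoeff μ f ξ.rep i j‖ ^ 2)) ^ (1 / 2 : ℝ)

/-- Membership in the Sobolev space `H^α_𝓛(G)`. -/
def MemSobolev (𝔪 : BiinvariantMetric E G) (μ : Measure G) (α : ℝ) (f : Lp ℂ 2 μ) : Prop :=
  sobolevNorm 𝔪 μ α f < ⊤

end Fourier

/-- The time interval `[0, T)`, for `T ∈ [0, ∞]`. -/
def timeInterval (T : ℝ≥0∞) : Set ℝ := {t | 0 ≤ t ∧ ENNReal.ofReal t < T}

section Solutions

variable {E : Type*} [NormedAddCommGroup E] [NormedSpace ℝ E]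
variable {G : Type*} [TopologicalSpace G] [ChartedSpace E G]

variable (E) in
/-- Test functions `φ ∈ C_0^∞([0, T) × G)` for compact `G`: they are smooth up to `t = 0` (given by
a smooth function on `ℝ × G`) and vanish for `t ≥ R`, for some `R < T`; the values at negative
times play no role. -/
def IsTestFunction (T : ℝ≥0∞) (φ : ℝ × G → ℂ) : Prop :=
  ContMDiff (𝓘(ℝ, ℝ).prod 𝓘(ℝ, E)) 𝓘(ℝ, ℂ) ∞ φ ∧
    ∃ R ∈ timeInterval T, ∀ s, R ≤ s → ∀ x, φ (s, x) = 0

/-- `∂_s φ`. -/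
def timeDeriv (φ : ℝ × G → ℂ) (s : ℝ) (x : G) : ℂ := deriv (fun r => φ (r, x)) s

/-- `∂_s² φ`. -/
def timeDeriv₂ (φ : ℝ × G → ℂ) (s : ℝ) (x : G) : ℂ := iteratedDeriv 2 (fun r => φ (r, x)) s

variable [MeasurableSpace G]

/-- The curve `u` of `L²` functions, as a function of `(t, x)`, lies in `L^p_loc([0, T) × G)` for
compact `G`: it has a representative `w` on `[0, T) × G` whose restriction to each `[0, R] × G`,
`R < T`, is in `L^p`. -/
def MemLpLoc (μ : Measure G) (p : ℝ) (T : ℝ≥0∞) (u : ℝ → Lp ℂ 2 μ) : Prop :=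
  ∃ w : ℝ × G → ℂ,
    (∀ᵐ s ∂(volume.restrict (timeInterval T)), (fun x => w (s, x)) =ᵐ[μ] u s) ∧
    ∀ R ∈ timeInterval T,
      MemLp w (ENNReal.ofReal p) ((volume.restrict (Icc (0 : ℝ) R)).prod μ)

variable [FiniteDimensional ℝ E] [Group G]

/-- `u` is an energy solution on `[0, T)`, `0 < T ≤ ∞`, of
`∂_t² u + (-𝓛)^α u = |u|^p`, `u(0) = ε u₀`, `∂_t u(0) = ε u₁`. -/
structure IsEnergySolution (𝔪 : BiinvariantMetric E G) (μ : Measure G) (α p ε : ℝ)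
    (u₀ u₁ : Lp ℂ 2 μ) (T : ℝ≥0∞) (u : ℝ → Lp ℂ 2 μ) : Prop where
  pos : 0 < T
  /-- `u(t) ∈ H^α_𝓛(G)` for `t ∈ [0, T)`. -/
  memSobolev : ∀ t ∈ timeInterval T, MemSobolev 𝔪 μ α (u t)
  /-- `u ∈ C([0, T), H^α_𝓛(G))`. -/
  continuous_sobolev : ∀ t ∈ timeInterval T,
    Tendsto (fun s => sobolevNorm 𝔪 μ α (u s - u t)) (𝓝[timeInterval T] t) (𝓝 0)
  /-- `u ∈ C¹([0, T), L²(G))`. -/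
  contDiff : ContDiffOn ℝ 1 u (timeInterval T)
  memLpLoc : MemLpLoc μ p T u
  /-- The weak formulation. -/
  weak : ∀ φ : ℝ × G → ℂ, IsTestFunction E T φ → ∀ t : ℝ, 0 < t → ENNReal.ofReal t < T →
    (∫ x, (derivWithin u (timeInterval T) t) x * φ (t, x) ∂μ)
      - (∫ x, u t x * timeDeriv φ t x ∂μ)
      + (ε : ℂ) * (∫ x, u₀ x * timeDeriv φ 0 x ∂μ)
      - (ε : ℂ) * (∫ x, u₁ x * φ (0, x) ∂μ)
      + (∫ s in (0 : ℝ)..t, ∫ x, u s x *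
          (timeDeriv₂ φ s x + fracLaplacian 𝔪 μ α (fun y => φ (s, y)) x) ∂μ)
    = ∫ s in (0 : ℝ)..t, ∫ x, ((‖u s x‖ ^ p : ℝ) : ℂ) * φ (s, x) ∂μ

/-- The lifespan `T(ε) ∈ [0, ∞]`: the supremum of all `T` for which there is an energy solution on
`[0, T)`. -/
def lifespan (𝔪 : BiinvariantMetric E G) (μ : Measure G) (α p ε : ℝ) (u₀ u₁ : Lp ℂ 2 μ) : ℝ≥0∞ :=
  sSup {T | ∃ u : ℝ → Lp ℂ 2 μ, IsEnergySolution 𝔪 μ α p ε u₀ u₁ T u}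

open Classical in
/-- `b(p) = p + 1` if `u₁ ≠ 0`, and `b(p) = 2` if `u₁ = 0`. -/
def bExponent {μ : Measure G} (p : ℝ) (u₁ : Lp ℂ 2 μ) : ℝ := if u₁ ≠ 0 then p + 1 else 2

end Solutions

end FracWave

end

namespace FracWave

/-! ### Constants lie in the kernel of the fractional Laplacian -/

section Constants

variable {G : Type*} [TopologicalSpace G] [Group G]

/-! Everything reduces to an ordinary differential inequality for the spatial mean `F(t) = ∫ u(t)`.
Functions constant in space are admissible tests because `G` is compact, and `(-𝓛)^α` kills them
(`fracLaplacian_const`). Testing with `t - s` in time gives `F(t) = ε U₀ + ε U₁ t + ∫₀ᵗ (t - s) ∫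
|u(s)|^p ds`, where `U₀`, `U₁` are the means of the data (`mean_eq`). Jensen's inequality bounds `∫
|u|^p` below by `F^p`, so `F'' ≥ F^p` in integrated form.

Such an `F`, once at least `M > 0` at time `t₀`, cannot live beyond `t₀ + K M^{-(p-1)/2}`
(`lt_of_increment_growth`). If `u₁ = 0`, take `t₀ = 0` and `M = ε U₀`. Otherwise the linear term
gives `M = ε U₁ t₀`, and balancing `t₀` against `(ε t₀)^{-(p-1)/2}` yields the exponent
`(p-1)/(p+1)`. -/

lemma UnitaryIrrep.mat_mul (ξ : UnitaryIrrep G) (x y : G) :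
    ξ.mat (x * y) = ξ.mat x * ξ.mat y := by
  simp [UnitaryIrrep.mat]

lemma UnitaryIrrep.continuous_mat_apply (ξ : UnitaryIrrep G) (i j : Fin ξ.dim) :
    Continuous fun x => ξ.mat x i j := by
  have h : Continuous ξ.mat := continuous_subtype_val.comp ξ.continuous_hom
  exact h.matrix_elem i j

/-- An irreducible representation with a nonzero invariant vector is trivial. -/
lemma UnitaryIrrep.eq_one_of_invariant (ξ : UnitaryIrrep G) (v : Fin ξ.dim → ℂ) (hv : v ≠ 0)
    (h : ∀ g, ξ.mat g *ᵥ v = v) (g : G) : ξ.mat g = 1 := by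
  let W : Submodule ℂ (Fin ξ.dim → ℂ) :=
    { carrier := {w | ∀ g, ξ.mat g *ᵥ w = w}
      add_mem' := fun {a b} ha hb g => by rw [Matrix.mulVec_add, ha g, hb g]
      zero_mem' := fun g => Matrix.mulVec_zero _
      smul_mem' := fun c a ha g => by rw [Matrix.mulVec_smul, ha g] }
  have hvW : v ∈ W := h
  rcases ξ.irreducible W (fun x w hw => by
    have : ξ.mat x *ᵥ w = w := hw x
    change ξ.mat x *ᵥ w ∈ W
    rwa [this]) with hW | hW
  · rw [hW] at hvW
    exact absurd ((Submodule.mem_bot ℂ).1 hvW) hv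
  · refine Matrix.ext_of_mulVec_single fun i => ?_
    have : Pi.single i (1 : ℂ) ∈ W := by rw [hW]; trivial
    rw [this g, Matrix.one_mulVec]

section

variable {E : Type*} [NormedAddCommGroup E] [NormedSpace ℝ E] [FiniteDimensional ℝ E]
  [ChartedSpace E G] (𝔪 : BiinvariantMetric E G)

lemma laplacian_const (c : ℂ) (x : G) : 𝔪.laplacian (fun _ => c) x = 0 := by
  have h : ∀ v (c : ℂ), leftDeriv (E := E) v (fun _ : G => c) = fun _ => 0 := by
    intro v c
    funext y
    simp only [leftDeriv, mfderiv_const]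
    rfl
  simp [BiinvariantMetric.laplacian, h]

lemma eigenvalue_trivial (ξ : UnitaryIrrep G) (hξ : ∀ g, ξ.mat g = 1) :
    eigenvalue 𝔪 ξ = 0 := by
  have h : ∀ (i j : Fin ξ.dim) (x : G),
      -𝔪.laplacian (fun y => ξ.mat y i j) x = (eigenvalue 𝔪 ξ : ℂ) * ξ.mat x i j :=
    Classical.epsilon_spec (p := fun l : ℝ => ∀ (i j : Fin ξ.dim) (x : G),
      -𝔪.laplacian (fun y => ξ.mat y i j) x = (l : ℂ) * ξ.mat x i j)
      ⟨0, fun i j x => by simp [hξ, laplacian_const]⟩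
  -- A diagonal entry of the identity is 1, so it pins down the chosen eigenvalue.
  have h' := h ⟨0, ξ.dim_pos⟩ ⟨0, ξ.dim_pos⟩ 1
  simp only [hξ, laplacian_const, Matrix.one_apply_eq, mul_one, neg_zero] at h'
  exact_mod_cast h'.symm

end

variable [IsTopologicalGroup G] [CompactSpace G] [MeasurableSpace G] [BorelSpace G]
  (μ : Measure G) [μ.IsHaarMeasure]

/-- The mean of a nontrivial irreducible representation vanishes. -/
lemma UnitaryIrrep.integral_mat_eq_zero (ξ : UnitaryIrrep G) (hξ : ∃ g, ξ.mat g ≠ 1)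
    (i j : Fin ξ.dim) : ∫ x, ξ.mat x i j ∂μ = 0 := by
  obtain ⟨g₀, hg₀⟩ := hξ
  have hint : ∀ i j, Integrable (fun x => ξ.mat x i j) μ := fun i j =>
    (ξ.continuous_mat_apply i j).integrable_of_hasCompactSupport (HasCompactSupport.of_compactSpace _)
  by_contra hne
  -- By invariance of Haar measure, each column of `∫ ξ` is a fixed vector of `ξ`; a nonzero one
  -- would make `ξ` trivial.
  refine hg₀ (ξ.eq_one_of_invariant (fun k => ∫ x, ξ.mat x k j ∂μ)
    (fun h => hne (congrFun h i)) (fun g => ?_) g₀)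
  funext k
  calc (ξ.mat g *ᵥ fun k => ∫ x, ξ.mat x k j ∂μ) k
      = ∑ l, ∫ x, ξ.mat g k l * ξ.mat x l j ∂μ := by
        simp [Matrix.mulVec, dotProduct, integral_const_mul]
    _ = ∫ x, ξ.mat (g * x) k j ∂μ := by
        rw [← integral_finsetSum _ fun l _ => (hint l j).const_mul _]
        simp only [ξ.mat_mul, Matrix.mul_apply]
    _ = ∫ x, ξ.mat x k j ∂μ := integral_mul_left_eq_self (fun x => ξ.mat x k j) g

lemma fourierCoeff_const (ξ : UnitaryIrrep G) (hξ : ∃ g, ξ.mat g ≠ 1) (c : ℂ) :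
    fourierCoeff μ (fun _ => c) ξ = 0 := by
  ext i j
  simp only [fourierCoeff, Matrix.of_apply, Matrix.conjTranspose_apply, Matrix.zero_apply,
    RCLike.star_def]
  rw [integral_const_mul, integral_conj, ξ.integral_mat_eq_zero μ hξ, map_zero, mul_zero]

variable {E : Type*} [NormedAddCommGroup E] [NormedSpace ℝ E] [FiniteDimensional ℝ E]
  [ChartedSpace E G] (𝔪 : BiinvariantMetric E G)

/-- Nontrivial classes have zero Fourier coefficient, and the trivial one has multiplier `0 ^ α`,
which vanishes only because `α ≠ 0`. -/
lemma fracLaplacian_const {α : ℝ} (hα : α ≠ 0) (c : ℂ) (x : G) :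
    fracLaplacian 𝔪 μ α (fun _ => c) x = 0 := by
  refine (tsum_congr fun ξ => ?_).trans tsum_zero
  by_cases hξ : ∃ g, ξ.rep.mat g ≠ 1
  · simp [fourierCoeff_const μ ξ.rep hξ]
  · push Not at hξ
    simp [eigenvalue_trivial 𝔪 ξ.rep hξ, Real.zero_rpow hα]

end Constants

/-! ### Blow-up for `F'' ≥ F^p` in integrated form -/

section Blowup

/-- Superquadratic growth of the increments forces blow-up before an explicit time. -/
lemma lt_of_increment_growth {p τ t₀ M : ℝ} (hp : 1 < p) (hM : 0 < M) (ht₀ : 0 ≤ t₀) {F : ℝ → ℝ}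
    (hF0 : M ≤ F t₀)
    (hF : ∀ t h, 0 ≤ t → 0 ≤ h → t + h ≤ τ → 0 ≤ F t → F t + h ^ 2 / 2 * F t ^ p ≤ F (t + h)) :
    τ < t₀ + √2 * (1 - 2 ^ (-((p - 1) / 2)))⁻¹ * M ^ (-((p - 1) / 2)) := by
  by_contra! hτ
  set q : ℝ := (p - 1) / 2 with hq
  have hq0 : 0 < q := by rw [hq]; linarith
  set r : ℝ := 2 ^ (-q) with hr
  have hr0 : 0 < r := by positivity
  have hr1 : r < 1 := Real.rpow_lt_one_of_one_lt_of_neg (by norm_num) (by linarith)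
  -- The step `h = c r^k = √2 (2^k M)^{-q}` solves `h²/2 · (2^k M)^p = 2^k M`, so `F` at least
  -- doubles across it. The steps are geometric, hence all the times `t k` stay below a finite
  -- limit.
  set c : ℝ := √2 * M ^ (-q) with hc
  have hc0 : 0 < c := by positivity
  set t : ℕ → ℝ := fun k => t₀ + c * ∑ i ∈ Finset.range k, r ^ i with ht
  have htlim : t₀ + c * (1 - r)⁻¹ ≤ τ := by
    refine le_of_eq_of_le ?_ hτ
    rw [hc]; ring
  have ht_le : ∀ k, t k ≤ t₀ + c * (1 - r)⁻¹ := by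
    intro k
    have := Summable.sum_le_tsum (Finset.range k) (fun i _ => by positivity)
      (summable_geometric_of_lt_one hr0.le hr1)
    rw [tsum_geometric_of_lt_one hr0.le hr1] at this
    simp only [ht]
    gcongr
  have ht_nonneg : ∀ k, 0 ≤ t k := fun k => by
    simp only [ht]; positivity
  have hdouble : ∀ k, 2 ^ k * M ≤ F (t k) := by
    intro k
    induction k with
    | zero => simpa [ht] using hF0
    | succ k ih =>
      have hMk : 0 < 2 ^ k * M := by positivity
      have hFk : 0 < F (t k) := hMk.trans_le ih
      have hstep : t k + c * r ^ k = t (k + 1) := by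
        simp only [ht, Finset.sum_range_succ]; ring
      have h1 := hF (t k) (c * r ^ k) (ht_nonneg k) (by positivity)
        (hstep ▸ (ht_le (k + 1)).trans htlim) hFk.le
      rw [hstep] at h1
      have hcr : c * r ^ k = √2 * (2 ^ k * M) ^ (-q) := by
        rw [hc, hr, Real.mul_rpow (by positivity) hM.le, ← Real.rpow_natCast,
          ← Real.rpow_natCast, ← Real.rpow_mul (by norm_num), ← Real.rpow_mul (by norm_num)]
        rw [show -q * (k : ℝ) = k * -q by ring]; ring
      have h2 : (c * r ^ k) ^ 2 / 2 = (2 ^ k * M) ^ (-(p - 1)) := by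
        rw [hcr, mul_pow, Real.sq_sqrt (by norm_num), ← Real.rpow_natCast ((2 ^ k * M) ^ (-q)),
          ← Real.rpow_mul hMk.le]
        rw [show -q * ((2 : ℕ) : ℝ) = -(p - 1) by push_cast; rw [hq]; ring]; ring
      have h3 : 2 ^ k * M ≤ (c * r ^ k) ^ 2 / 2 * F (t k) ^ p := by
        calc 2 ^ k * M = (2 ^ k * M) ^ (-(p - 1)) * (2 ^ k * M) ^ p := by
              rw [← Real.rpow_add hMk]
              rw [show -(p - 1) + p = 1 by ring, Real.rpow_one]
          _ ≤ _ := by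
              rw [h2]
              gcongr
      calc 2 ^ (k + 1) * M = 2 ^ k * M + 2 ^ k * M := by ring
        _ ≤ F (t k) + (c * r ^ k) ^ 2 / 2 * F (t k) ^ p := add_le_add ih h3
        _ ≤ _ := h1
  -- At the limit time, `F s` would exceed `2^k M` for every `k`.
  set s := t₀ + c * (1 - r)⁻¹
  obtain ⟨k, hk⟩ := pow_unbounded_of_one_lt (F s / M) (one_lt_two (α := ℝ))
  rw [div_lt_iff₀ hM] at hk
  have hFk : 0 ≤ F (t k) := le_trans (by positivity) (hdouble k)
  have h1 := hF (t k) (s - t k) (ht_nonneg k) (sub_nonneg.2 (ht_le k)) (by linarith) hFk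
  rw [add_sub_cancel] at h1
  have h2 : 0 ≤ (s - t k) ^ 2 / 2 * F (t k) ^ p := by positivity
  linarith [hdouble k]

/-- Passing from `t` to `t + h` only increases the linear term and the kernel on `[0, t]`. The new
part of the integral has `N ≥ F^p ≥ F(t)^p`, as `F` stays above `F(t)`, and its kernel has mass
`h²/2`. -/
lemma increment_growth {p τ a b : ℝ} (hp : 1 < p) (hb : 0 ≤ b) {N : ℝ → ℝ}
    (hN : ∀ s, 0 ≤ N s) (hint : IntegrableOn N (Icc 0 τ)) {F : ℝ → ℝ}
    (hF : ∀ t, F t = a + b * t + ∫ s in (0 : ℝ)..t, (t - s) * N s)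
    (hFN : ∀ᵐ s ∂(volume.restrict (Icc 0 τ)), F s ^ p ≤ N s)
    {t h : ℝ} (ht : 0 ≤ t) (hh : 0 ≤ h) (hth : t + h ≤ τ) (hFt : 0 ≤ F t) :
    F t + h ^ 2 / 2 * F t ^ p ≤ F (t + h) := by
  have hii : ∀ c x y : ℝ, 0 ≤ x → x ≤ y → y ≤ τ →
      IntervalIntegrable (fun s => (c - s) * N s) volume x y := by
    intro c x y hx hxy hy
    have : IntervalIntegrable N volume x y :=
      (intervalIntegrable_iff_integrableOn_Icc_of_le hxy).2 (hint.mono_set (Icc_subset_Icc hx hy))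
    exact this.continuousOn_mul (by fun_prop)
  have key : ∀ h, 0 ≤ h → t + h ≤ τ →
      F t + ∫ s in t..(t + h), (t + h - s) * N s ≤ F (t + h) := by
    intro h hh hth
    rw [hF t, hF (t + h), ← intervalIntegral.integral_add_adjacent_intervals
      (hii (t + h) 0 t le_rfl ht (by linarith)) (hii (t + h) t (t + h) ht (by linarith) hth)]
    have : ∫ s in (0 : ℝ)..t, (t - s) * N s ≤ ∫ s in (0 : ℝ)..t, (t + h - s) * N s :=
      intervalIntegral.integral_mono_on ht (hii t 0 t le_rfl ht (by linarith))
        (hii (t + h) 0 t le_rfl ht (by linarith)) fun s _ =>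
          mul_le_mul_of_nonneg_right (by linarith) (hN s)
    nlinarith [mul_nonneg hb hh]
  have hmono : ∀ s ∈ Icc t (t + h), F t ≤ F s := by
    intro s hs
    have h1 := key (s - t) (by linarith [hs.1]) (by linarith [hs.2])
    rw [add_sub_cancel] at h1
    have : 0 ≤ ∫ r in t..s, (s - r) * N r :=
      intervalIntegral.integral_nonneg hs.1 fun r hr =>
        mul_nonneg (by linarith [hr.2]) (hN r)
    linarith
  refine le_trans ?_ (key h hh hth)
  have hconst : ∫ s in t..(t + h), (t + h - s) * F t ^ p = h ^ 2 / 2 * F t ^ p := by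
    rw [intervalIntegral.integral_mul_const]
    congr 1
    rw [intervalIntegral.integral_comp_sub_left (fun x => x) (t + h)]
    simp
  rw [← hconst]
  gcongr
  refine intervalIntegral.integral_mono_ae_restrict (by linarith)
    (Continuous.intervalIntegrable (by fun_prop) _ _)
    (hii (t + h) t (t + h) ht (by linarith) hth) ?_
  have hsub : Icc t (t + h) ⊆ Icc 0 τ := Icc_subset_Icc ht hth
  filter_upwards [ae_restrict_of_ae_restrict_of_subset hsub hFN, ae_restrict_mem measurableSet_Icc]
    with s hs hs'
  have := hs'.2
  refine mul_le_mul_of_nonneg_left (le_trans ?_ hs) (by linarith)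
  exact Real.rpow_le_rpow hFt (hmono s hs') (by linarith)

end Blowup

/-! ### The spatial mean of an energy solution -/

section Means

/-- A smooth cutoff that is `1` near `[0, t]` and vanishes beyond some `R < T`. -/
lemma exists_cutoff {T : ℝ≥0∞} {t : ℝ} (ht : 0 < t) (htT : ENNReal.ofReal t < T) :
    ∃ χ : ℝ → ℝ, ContDiff ℝ ∞ χ ∧ (∃ R ∈ timeInterval T, ∀ s, R ≤ s → χ s = 0) ∧
      ∀ s ∈ Icc 0 t, χ =ᶠ[𝓝 s] fun _ => 1 := by
  obtain ⟨R, htR, hRT⟩ : ∃ R : ℝ, t < R ∧ ENNReal.ofReal R < T := by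
    obtain ⟨c, hc, hcT⟩ := ENNReal.lt_iff_exists_nnreal_btwn.1 htT
    refine ⟨c, (ENNReal.ofReal_lt_coe_iff ht.le).1 hc, by simpa using hcT⟩
  let b : ContDiffBump (0 : ℝ) := ⟨(t + R) / 2, R, by linarith, by linarith⟩
  refine ⟨b, b.contDiff, ⟨R, ⟨by linarith, hRT⟩, fun s hs => b.zero_of_le_dist ?_⟩, fun s hs => ?_⟩
  · simpa using hs.trans (le_abs_self s)
  · refine b.eventuallyEq_one_of_mem_ball ?_
    rw [Metric.mem_ball, dist_zero_right, Real.norm_eq_abs, abs_of_nonneg hs.1]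
    change s < (t + R) / 2
    linarith [hs.2]

lemma Icc_subset_timeInterval {T : ℝ≥0∞} {t : ℝ} (htT : ENNReal.ofReal t < T) :
    Icc 0 t ⊆ timeInterval T := fun _ hs =>
  ⟨hs.1, (ENNReal.ofReal_le_ofReal hs.2).trans_lt htT⟩

section

variable {X : Type*} [MeasurableSpace X] {μ : Measure X}

lemma integral_eq_ofReal {f : Lp ℂ 2 μ} (hf : ∀ᵐ x ∂μ, 0 ≤ f x) :
    ∫ x, f x ∂μ = ((∫ x, (f x).re ∂μ : ℝ) : ℂ) := by
  rw [← integral_complex_ofReal]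
  refine integral_congr_ae ?_
  filter_upwards [hf] with x hx
  exact Complex.eq_re_of_ofReal_le hx

variable [IsProbabilityMeasure μ]

/-- Space integrability of `|u|^p`, and time integrability of its mean. -/
lemma MemLpLoc.integrable {p : ℝ} (hp : 1 < p) {u : ℝ → Lp ℂ 2 μ} {T : ℝ≥0∞}
    (hu : MemLpLoc μ p T u) {τ : ℝ}
    (hτ : τ ∈ timeInterval T) :
    (∀ᵐ s ∂(volume.restrict (Icc 0 τ)), Integrable (fun x => ‖u s x‖ ^ p) μ) ∧
      IntegrableOn (fun s => ∫ x, ‖u s x‖ ^ p ∂μ) (Icc 0 τ) := by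
  obtain ⟨w, hw, hwp⟩ := hu
  have hp0 : 0 < p := by linarith
  have hint := (hwp τ hτ).integrable_norm_rpow (by simpa using hp0) ENNReal.ofReal_ne_top
  rw [ENNReal.toReal_ofReal hp0.le] at hint
  have hw' := ae_restrict_of_ae_restrict_of_subset (Icc_subset_timeInterval hτ.2) hw
  have hcongr : ∀ᵐ s ∂(volume.restrict (Icc 0 τ)),
      (fun x => ‖w (s, x)‖ ^ p) =ᵐ[μ] fun x => ‖u s x‖ ^ p := by
    filter_upwards [hw'] with s hs
    filter_upwards [hs] with x hx
    rw [hx]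
  constructor
  · filter_upwards [hint.prod_right_ae, hcongr] with s h1 h2
    exact h1.congr h2
  · refine hint.integral_prod_left.congr ?_
    filter_upwards [hcongr] with s hs
    exact integral_congr_ae hs

/-- Jensen's inequality for `x ↦ x^p`; this is where total mass one enters. -/
lemma norm_integral_rpow_le {p : ℝ} (hp : 1 < p) (f : Lp ℂ 2 μ)
    (hf : Integrable (fun x => ‖f x‖ ^ p) μ) : ‖∫ x, f x ∂μ‖ ^ p ≤ ∫ x, ‖f x‖ ^ p ∂μ := by
  have hfi : Integrable f μ := (Lp.memLp f).integrable one_le_two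
  calc ‖∫ x, f x ∂μ‖ ^ p ≤ (∫ x, ‖f x‖ ∂μ) ^ p :=
        Real.rpow_le_rpow (norm_nonneg _) (norm_integral_le_integral_norm _) (by linarith)
    _ ≤ _ := (convexOn_rpow hp.le).map_integral_le
        (continuousOn_id.rpow_const fun x _ => Or.inr (by linarith)) isClosed_Ici
        (ae_of_all _ fun x => norm_nonneg _) hfi.norm hf

lemma integral_re_pos {f : Lp ℂ 2 μ} (hf : ∀ᵐ x ∂μ, 0 ≤ f x) (hne : f ≠ 0) :
    0 < ∫ x, (f x).re ∂μ := by
  have hre : 0 ≤ᵐ[μ] fun x => (f x).re := hf.mono fun x hx => (Complex.le_def.1 hx).1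
  have hint : Integrable (fun x => (f x).re) μ := ((Lp.memLp f).integrable one_le_two).re
  refine (integral_nonneg_of_ae hre).lt_of_ne' fun h => hne ?_
  rw [Lp.eq_zero_iff_ae_eq_zero]
  filter_upwards [(integral_eq_zero_iff_of_nonneg_ae hre hint).1 h, hf] with x h1 h2
  rw [Complex.eq_re_of_ofReal_le h2]
  simpa using h1

end

variable {E : Type*} [NormedAddCommGroup E] [NormedSpace ℝ E] [FiniteDimensional ℝ E]
  {G : Type*} [TopologicalSpace G] [CompactSpace G] [ChartedSpace E G] [Group G]
  [IsTopologicalGroup G] [MeasurableSpace G] [BorelSpace G]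
  {μ : Measure G} [μ.IsHaarMeasure]
  {𝔪 : BiinvariantMetric E G} {α p ε : ℝ} {u₀ u₁ : Lp ℂ 2 μ} {T : ℝ≥0∞} {u : ℝ → Lp ℂ 2 μ}

/-- The weak formulation tested with a function that is affine in time on `[0, t]` and constant
in space. -/
lemma IsEnergySolution.affine_test (hu : IsEnergySolution 𝔪 μ α p ε u₀ u₁ T u) (hα : α ≠ 0)
    {t : ℝ} (ht : 0 < t) (htT : ENNReal.ofReal t < T) (a b : ℝ) :
    (∫ x, (derivWithin u (timeInterval T) t) x ∂μ) * (a + b * t)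
      - (∫ x, u t x ∂μ) * b + ε * (∫ x, u₀ x ∂μ) * b - ε * (∫ x, u₁ x ∂μ) * a
    = ((∫ s in (0 : ℝ)..t, (∫ x, ‖u s x‖ ^ p ∂μ) * (a + b * s) : ℝ) : ℂ) := by
  obtain ⟨χ, hχ, ⟨R, hR, hχR⟩, hχ1⟩ := exists_cutoff ht htT
  -- The cutoff equals 1 on a neighbourhood of each point of `[0, t]`, so time derivatives are those
  -- of the affine function even at the endpoints.
  let ψ : ℝ → ℂ := fun s => ((χ s * (a + b * s) : ℝ) : ℂ)
  have hψ : ContDiff ℝ ∞ ψ := Complex.ofRealCLM.contDiff.comp (hχ.mul (by fun_prop))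
  have hψe : ∀ s ∈ Icc 0 t, ψ =ᶠ[𝓝 s] fun s => (a : ℂ) + b * s := fun s hs => by
    filter_upwards [hχ1 s hs] with r hr
    simp [ψ, hr]
  have hd : ∀ s : ℝ, deriv (fun s : ℝ => (a : ℂ) + b * s) s = b := fun s => by
    have h := ((hasDerivAt_id s).ofReal_comp.const_mul (b : ℂ)).const_add (a : ℂ)
    simpa using h.deriv
  have hψ1 : ∀ s ∈ Icc 0 t, deriv ψ s = b := fun s hs => by
    rw [(hψe s hs).deriv_eq, hd]
  have hψ2 : ∀ s ∈ Icc 0 t, iteratedDeriv 2 ψ s = 0 := fun s hs => by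
    rw [(hψe s hs).iteratedDeriv_eq 2, iteratedDeriv_succ, iteratedDeriv_one, funext hd]
    simp
  have h0 : (0 : ℝ) ∈ Icc 0 t := ⟨le_rfl, ht.le⟩
  have ht' : t ∈ Icc 0 t := ⟨ht.le, le_rfl⟩
  have h := hu.weak (fun z => ψ z.1)
    ⟨hψ.contMDiff.comp contMDiff_fst, R, hR, fun s hs x => by simp [ψ, hχR s hs]⟩ t ht htT
  simp only [timeDeriv, timeDeriv₂, fracLaplacian_const μ 𝔪 hα, add_zero, hψ1 _ h0, hψ1 _ ht',
    integral_mul_const, (hψe _ h0).eq_of_nhds, (hψe _ ht').eq_of_nhds] at h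
  have hz : ∫ s in (0 : ℝ)..t, (∫ x, u s x ∂μ) * iteratedDeriv 2 ψ s = 0 := by
    rw [intervalIntegral.integral_congr (g := fun _ => 0)]
    · simp
    · intro s hs
      rw [uIcc_of_le ht.le] at hs
      simp [hψ2 s hs]
  have hr : ∫ s in (0 : ℝ)..t, (∫ x, ((‖u s x‖ ^ p : ℝ) : ℂ) ∂μ) * ψ s
      = ((∫ s in (0 : ℝ)..t, (∫ x, ‖u s x‖ ^ p ∂μ) * (a + b * s) : ℝ) : ℂ) := by
    rw [← intervalIntegral.integral_ofReal]
    refine intervalIntegral.integral_congr fun s hs => ?_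
    rw [uIcc_of_le ht.le] at hs
    simp only [integral_complex_ofReal, (hψe s hs).eq_of_nhds]
    push_cast
    rfl
  rw [hz, hr] at h
  rw [← h]
  push_cast
  ring

/-- The spatial mean of an energy solution solves `F'' = ∫ |u|^p` in integrated form. -/
lemma IsEnergySolution.mean_eq (hu : IsEnergySolution 𝔪 μ α p ε u₀ u₁ T u) (hα : α ≠ 0)
    (hu₀ : ∀ᵐ x ∂μ, 0 ≤ u₀ x) (hu₁ : ∀ᵐ x ∂μ, 0 ≤ u₁ x)
    {t : ℝ} (ht : 0 < t) (htT : ENNReal.ofReal t < T) :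
    ∫ x, u t x ∂μ = ((ε * (∫ x, (u₀ x).re ∂μ) + ε * (∫ x, (u₁ x).re ∂μ) * t +
      ∫ s in (0 : ℝ)..t, (t - s) * ∫ x, ‖u s x‖ ^ p ∂μ : ℝ) : ℂ) := by
  -- The test function `t - s` vanishes at `s = t`, which removes the unknown `∂ₜu(t)`.
  have h := hu.affine_test hα ht htT t (-1)
  rw [integral_eq_ofReal hu₀, integral_eq_ofReal hu₁] at h
  have hc : ∫ s in (0 : ℝ)..t, (∫ x, ‖u s x‖ ^ p ∂μ) * (t + -1 * s) =
      ∫ s in (0 : ℝ)..t, (t - s) * ∫ x, ‖u s x‖ ^ p ∂μ := by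
    refine intervalIntegral.integral_congr fun s _ => ?_
    ring
  rw [hc] at h
  push_cast at h ⊢
  linear_combination h

variable [IsProbabilityMeasure μ]

/-- An energy solution whose mean is at least `M` at time `t₀` exists at most until
`t₀ + K M^{-(p-1)/2}`. -/
lemma IsEnergySolution.le_of_mean_growth (hu : IsEnergySolution 𝔪 μ α p ε u₀ u₁ T u) (hα : α ≠ 0)
    (hp : 1 < p) (hε : 0 < ε) (hu₀ : ∀ᵐ x ∂μ, 0 ≤ u₀ x) (hu₁ : ∀ᵐ x ∂μ, 0 ≤ u₁ x)
    {t₀ M : ℝ} (ht₀ : 0 ≤ t₀) (hM : 0 < M)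
    (hMF : M ≤ ε * (∫ x, (u₀ x).re ∂μ) + ε * (∫ x, (u₁ x).re ∂μ) * t₀) :
    T ≤ ENNReal.ofReal (t₀ + √2 * (1 - 2 ^ (-((p - 1) / 2)))⁻¹ * M ^ (-((p - 1) / 2))) := by
  have hU₁ : 0 ≤ ∫ x, (u₁ x).re ∂μ :=
    integral_nonneg_of_ae (hu₁.mono fun x hx => (Complex.le_def.1 hx).1)
  have hN : ∀ s, 0 ≤ ∫ x, ‖u s x‖ ^ p ∂μ := fun s =>
    integral_nonneg fun x => Real.rpow_nonneg (norm_nonneg _) _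
  -- It suffices to bound every finite `τ < T`, since `|u|^p` is integrable on `[0, τ] × G`.
  refine le_of_forall_lt fun c hc => ?_
  lift c to NNReal using hc.ne_top
  obtain ⟨τ, hcτ, hτT⟩ := ENNReal.lt_iff_exists_nnreal_btwn.1 hc
  have hτ : ENNReal.ofReal τ < T := by simpa using hτT
  refine hcτ.trans ?_
  rw [← ENNReal.ofReal_coe_nnreal]
  obtain ⟨hI, hint⟩ := hu.memLpLoc.integrable hp ⟨τ.2, hτ⟩
  have key := lt_of_increment_growth (τ := τ) hp hM ht₀
    (F := fun t => ε * (∫ x, (u₀ x).re ∂μ) + ε * (∫ x, (u₁ x).re ∂μ) * t +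
      ∫ s in (0 : ℝ)..t, (t - s) * ∫ x, ‖u s x‖ ^ p ∂μ)
    (hMF.trans (le_add_of_nonneg_right (intervalIntegral.integral_nonneg ht₀ fun s hs =>
      mul_nonneg (by linarith [hs.2]) (hN s))))
    (fun t h h1 h2 h3 h4 => increment_growth hp (mul_nonneg hε.le hU₁) hN hint (fun t => rfl) ?_
      h1 h2 h3 h4)
  · exact (ENNReal.ofReal_lt_ofReal_iff (lt_of_le_of_lt τ.2 key)).2 key
  -- The mean formula is available only at positive times; `s = 0` is a null set.
  · have h0 : ∀ᵐ s ∂(volume.restrict (Icc 0 (τ : ℝ))), s ≠ 0 :=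
      ae_restrict_of_ae (Measure.ae_ne volume 0)
    filter_upwards [hI, ae_restrict_mem measurableSet_Icc, h0] with s hs hs' hs0
    refine le_trans ?_ (norm_integral_rpow_le hp (u s) hs)
    rw [hu.mean_eq hα hu₀ hu₁ (hs'.1.lt_of_ne' hs0) (Icc_subset_timeInterval hτ hs').2,
      Complex.norm_real, Real.norm_eq_abs]
    refine Real.rpow_le_rpow ?_ (le_abs_self _) (by linarith)
    have : 0 ≤ ∫ r in (0 : ℝ)..s, (s - r) * ∫ x, ‖u r x‖ ^ p ∂μ :=
      intervalIntegral.integral_nonneg hs'.1 fun r hr =>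
        mul_nonneg (by linarith [hr.2]) (hN r)
    have h₀ : 0 ≤ ∫ x, (u₀ x).re ∂μ :=
      integral_nonneg_of_ae (hu₀.mono fun x hx => (Complex.le_def.1 hx).1)
    have := hs'.1
    positivity

end Means

end FracWave

theorem theorem1p3
    {E : Type*} [NormedAddCommGroup E] [NormedSpace ℝ E] [FiniteDimensional ℝ E]
    {G : Type*} [TopologicalSpace G] [T2Space G] [CompactSpace G] [ChartedSpace E G] [Group G]
    [LieGroup 𝓘(ℝ, E) ∞ G] [MeasurableSpace G] [BorelSpace G]
    (μ : Measure G) [μ.IsHaarMeasure] [IsProbabilityMeasure μ]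
    (𝔪 : FracWave.BiinvariantMetric E G)
    (p : ℝ) (hp : 1 < p)
    (u₀ u₁ : Lp ℂ 2 μ)
    (hu₀ : ∀ᵐ x ∂μ, 0 ≤ u₀ x) (hu₁ : ∀ᵐ x ∂μ, 0 ≤ u₁ x)
    (hne : ¬(u₀ = 0 ∧ u₁ = 0)) :
    ∃ ε₀ : ℝ, 0 < ε₀ ∧ ∀ α : ℝ, 0 < α → α < 1 → FracWave.MemSobolev 𝔪 μ α u₀ →
      ∃ C : ℝ, 0 < C ∧ ∀ ε : ℝ, 0 < ε → ε ≤ ε₀ →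
        (∀ (T : ℝ≥0∞) (u : ℝ → Lp ℂ 2 μ),
          FracWave.IsEnergySolution 𝔪 μ α p ε u₀ u₁ T u → T < ⊤) ∧
        FracWave.lifespan 𝔪 μ α p ε u₀ u₁ ≤
          ENNReal.ofReal (C * ε ^ (-((p - 1) / FracWave.bExponent p u₁))) := by

  have := topologicalGroup_of_lieGroup (G := G) 𝓘(ℝ, E) ∞
  set K : ℝ := √2 * (1 - 2 ^ (-((p - 1) / 2)))⁻¹ with hK
  have hK0 : 0 < K := by
    have : (2 : ℝ) ^ (-((p - 1) / 2)) < 1 :=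
      Real.rpow_lt_one_of_one_lt_of_neg (by norm_num) (by linarith)
    have : 0 < 1 - (2 : ℝ) ^ (-((p - 1) / 2)) := by linarith
    positivity
  set U₀ : ℝ := ∫ x, (u₀ x).re ∂μ with hU₀
  set U₁ : ℝ := ∫ x, (u₁ x).re ∂μ with hU₁
  have hU₀0 : 0 ≤ U₀ := integral_nonneg_of_ae (hu₀.mono fun x hx => (Complex.le_def.1 hx).1)
  suffices h : ∀ α : ℝ, 0 < α → ∃ C : ℝ, 0 < C ∧ ∀ ε : ℝ, 0 < ε →
      ∀ (T : ℝ≥0∞) (u : ℝ → Lp ℂ 2 μ), FracWave.IsEnergySolution 𝔪 μ α p ε u₀ u₁ T u →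
        T ≤ ENNReal.ofReal (C * ε ^ (-((p - 1) / FracWave.bExponent p u₁))) by
    -- The bound holds for all `ε > 0`, so any threshold serves.
    refine ⟨1, one_pos, fun α hα _ _ => ?_⟩
    obtain ⟨C, hC, hbound⟩ := h α hα
    refine ⟨C, hC, fun ε hε _ => ⟨fun T u hu =>
      (hbound ε hε T u hu).trans_lt ENNReal.ofReal_lt_top, sSup_le ?_⟩⟩
    rintro T ⟨u, hu⟩
    exact hbound ε hε T u hu
  intro α hα
  by_cases h1 : u₁ = 0
  · have hU₀pos : 0 < U₀ := FracWave.integral_re_pos hu₀ fun h => hne ⟨h, h1⟩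
    have hU₁z : U₁ = 0 := by
      rw [hU₁]
      refine integral_eq_zero_of_ae ?_
      filter_upwards [(Lp.eq_zero_iff_ae_eq_zero).1 h1] with x hx
      simp [hx]
    refine ⟨K * U₀ ^ (-((p - 1) / 2)), by positivity, fun ε hε T u hu => ?_⟩
    refine (hu.le_of_mean_growth hα.ne' hp hε hu₀ hu₁ (t₀ := 0) (M := ε * U₀) le_rfl
      (by positivity) (by simp [hU₀])).trans (ENNReal.ofReal_le_ofReal (le_of_eq ?_))
    rw [FracWave.bExponent, if_neg (not_not.2 h1), Real.mul_rpow hε.le hU₀0, ← hK]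
    ring
  · have hU₁pos : 0 < U₁ := FracWave.integral_re_pos hu₁ h1
    refine ⟨1 + K * U₁ ^ (-((p - 1) / 2)), by positivity, fun ε hε T u hu => ?_⟩
    -- This `t₀` is the solution of `(ε t₀)^{-(p-1)/2} = t₀`, which makes both terms of the lifespan
    -- bound of the same order.
    set t₀ : ℝ := ε ^ (-((p - 1) / (p + 1))) with ht₀
    have ht₀0 : 0 < t₀ := by positivity
    refine (hu.le_of_mean_growth hα.ne' hp hε hu₀ hu₁ (t₀ := t₀) (M := ε * U₁ * t₀) ht₀0.le
      (by positivity) (le_add_of_nonneg_left (by positivity))).trans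
      (ENNReal.ofReal_le_ofReal (le_of_eq ?_))
    have hscale : (ε * t₀) ^ (-((p - 1) / 2)) = t₀ := by
      nth_rw 1 [← Real.rpow_one ε]
      rw [ht₀, ← Real.rpow_add hε, ← Real.rpow_mul hε.le]
      congr 1
      have : p + 1 ≠ 0 := by linarith
      field_simp
      ring
    rw [FracWave.bExponent, if_pos h1, ← ht₀, ← hK, mul_right_comm ε U₁ t₀,
      Real.mul_rpow (by positivity) hU₁pos.le, hscale]
    ring
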